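/- For $n\ge 0$ let $H_n=\sum_{j=1}^{n}\frac1j$ denote the $n$-th harmonic number, and let $\zeta$ denote the Riemann zeta function, so that $\zeta(3)=\sum_{k\ge1}k^{-3}$. Then the following series converges absolutely and $$\sum_{n=0}^{\infty}\frac{\binom{2n}{n}}{(2n+1)^2(-16)^n}\left(5H_{2n+1}+\frac{12}{2n+1}\right)=14\,\zeta(3).$$ -/

import Mathlib

open Filter Topology Finset

/-! A Wilf–Zeilberger argument. `wzF` and `wzG` are minus the `s`-derivatives of a hypergeometric
pair, with `wzF` coming from `halfProdSq n / (risingProd (2 * n) s * (s + n - 1 / 2) ^ 2)`;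
differentiation produces the harmonic sums. By `wzG_sub_wzG`, summation over a rectangle in `(n, s)`
leaves only boundary terms. The far edges vanish by the bounds `abs_wzF_le` and `abs_wzG_le`, so the
sum of `wzG n 1` (the target series) equals the sum of `wzF 0 (k + 1) = 16 / (2k + 1)^3`, which is
`16 · (7/8) ζ(3)`. -/

/-- The rising product `s (s + 1) ⋯ (s + m - 1)`. -/
noncomputable def risingProd (m : ℕ) (s : ℝ) : ℝ := ∏ j ∈ range m, (s + j)

/-- The shifted harmonic sum `1 / s + ⋯ + 1 / (s + m - 1)`. -/
noncomputable def risingHarmonic (m : ℕ) (s : ℝ) : ℝ := ∑ j ∈ range m, 1 / (s + j)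

/-- `(-1) ^ n` times the square of the rising factorial of `1 / 2`. -/
noncomputable def halfProdSq (n : ℕ) : ℝ := ∏ j ∈ range n, -((j : ℝ) + 1 / 2) ^ 2

/-- First member of the Wilf–Zeilberger pair. -/
noncomputable def wzF (n : ℕ) (s : ℝ) : ℝ :=
  halfProdSq n / (risingProd (2 * n) s * (s + n - 1 / 2) ^ 2) *
    (risingHarmonic (2 * n) s + 2 / (s + n - 1 / 2))

/-- Second member of the Wilf–Zeilberger pair. -/
noncomputable def wzG (n : ℕ) (s : ℝ) : ℝ :=
  halfProdSq n / risingProd (2 * n + 1) s *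
    (((s + 2 * n) / (s + n - 1 / 2) ^ 2 + 1 / (2 * n + 1)) * risingHarmonic (2 * n + 1) s
      - 1 / (s + n - 1 / 2) ^ 2 + 2 * (s + 2 * n) / (s + n - 1 / 2) ^ 3)

theorem risingProd_succ (m : ℕ) (s : ℝ) :
    risingProd (m + 1) s = risingProd m s * (s + m) := by
  simp [risingProd, prod_range_succ]

theorem risingProd_succ_shift (m : ℕ) (s : ℝ) :
    s * risingProd m (s + 1) = risingProd (m + 1) s := by
  rw [risingProd, risingProd, prod_range_succ', mul_comm]
  push_cast
  simp [add_comm, add_left_comm]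

theorem risingHarmonic_succ (m : ℕ) (s : ℝ) :
    risingHarmonic (m + 1) s = risingHarmonic m s + 1 / (s + m) := by
  simp [risingHarmonic, sum_range_succ]

theorem risingHarmonic_succ_shift (m : ℕ) (s : ℝ) :
    risingHarmonic m (s + 1) + 1 / s = risingHarmonic (m + 1) s := by
  rw [risingHarmonic, risingHarmonic, sum_range_succ']
  push_cast
  simp [add_comm, add_left_comm]

theorem risingProd_pos (m : ℕ) {s : ℝ} (hs : 0 < s) : 0 < risingProd m s :=
  prod_pos fun _ _ => by positivity

theorem halfProdSq_succ (n : ℕ) :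
    halfProdSq (n + 1) = halfProdSq n * -((n : ℝ) + 1 / 2) ^ 2 := by
  simp [halfProdSq, prod_range_succ]

/-! ### The Wilf–Zeilberger relation -/

theorem wzG_sub_wzG (n : ℕ) {s : ℝ} (hs : 1 ≤ s) :
    wzG n s - wzG n (s + 1) = wzF n s - wzF (n + 1) s := by
  have hn : (0 : ℝ) ≤ n := n.cast_nonneg
  have hs0 : s ≠ 0 := by positivity
  have hP := (risingProd_pos (2 * n) (s := s) (by positivity)).ne'
  have h1 : risingProd (2 * n + 1) s = risingProd (2 * n) s * (s + 2 * n) := by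
    rw [risingProd_succ]; push_cast; rfl
  have h2 : risingProd (2 * (n + 1)) s =
      risingProd (2 * n) s * (s + 2 * n) * (s + 2 * n + 1) := by
    rw [show 2 * (n + 1) = 2 * n + 1 + 1 by ring, risingProd_succ, h1]; push_cast; ring
  have h3 : risingProd (2 * n + 1) (s + 1) =
      risingProd (2 * n) s * (s + 2 * n) * (s + 2 * n + 1) / s := by
    rw [eq_div_iff hs0, mul_comm, risingProd_succ_shift, ← h2]; rfl
  have k1 : risingHarmonic (2 * n + 1) s = risingHarmonic (2 * n) s + 1 / (s + 2 * n) := by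
    rw [risingHarmonic_succ]; push_cast; rfl
  have k2 : risingHarmonic (2 * (n + 1)) s =
      risingHarmonic (2 * n) s + 1 / (s + 2 * n) + 1 / (s + 2 * n + 1) := by
    rw [show 2 * (n + 1) = 2 * n + 1 + 1 by ring, risingHarmonic_succ, k1]; push_cast; ring
  have k3 : risingHarmonic (2 * n + 1) (s + 1) =
      risingHarmonic (2 * n) s + 1 / (s + 2 * n) + 1 / (s + 2 * n + 1) - 1 / s := by
    rw [eq_sub_iff_add_eq, risingHarmonic_succ_shift, ← k2]; rfl
  rw [wzG, wzG, wzF, wzF, h1, h2, h3, k1, k2, k3, halfProdSq_succ]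
  generalize risingProd (2 * n) s = P at *
  generalize risingHarmonic (2 * n) s = h at *
  generalize halfProdSq n = p at *
  push_cast
  have hc : s + n - 1 / 2 ≠ 0 := by linarith
  have hc' : s + n - 1 / 2 + 1 ≠ 0 := by linarith
  have ha : s + 2 * (n : ℝ) ≠ 0 := by positivity
  have ha' : s + 2 * (n : ℝ) + 1 ≠ 0 := by positivity
  have hd : 2 * (n : ℝ) + 1 ≠ 0 := by positivity
  rw [show s + 1 + n - 1 / 2 = s + n - 1 / 2 + 1 by ring,
    show s + (n + 1) - 1 / 2 = s + n - 1 / 2 + 1 by ring,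
    show s + 1 + 2 * (n : ℝ) = s + 2 * n + 1 by ring,
    show (n : ℝ) + 1 / 2 = (2 * n + 1) / 2 by ring]
  clear h1 h2 h3 k1 k2 k3
  -- The linear factors become atoms so that `field_simp` clears them as denominators; substituting
  -- back leaves a polynomial identity.
  generalize hce : s + n - 1 / 2 = c at *
  generalize hae : s + 2 * (n : ℝ) = a at *
  generalize hde : 2 * (n : ℝ) + 1 = d at *
  field_simp
  subst hce hae hde
  ring

/-! ### Geometric bounds -/

theorem abs_halfProdSq_le (n : ℕ) {s : ℝ} (hs : 1 ≤ s) :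
    |halfProdSq n| * 4 ^ n ≤ risingProd (2 * n) s := by
  induction n with
  | zero => simp [halfProdSq, risingProd]
  | succ n ih =>
    have hn : (0 : ℝ) ≤ n := n.cast_nonneg
    rw [halfProdSq_succ, show 2 * (n + 1) = 2 * n + 1 + 1 by ring, risingProd_succ,
      risingProd_succ, abs_mul, abs_neg, abs_of_nonneg (sq_nonneg ((n : ℝ) + 1 / 2)), pow_succ]
    -- The left side is `(2n + 1)^2`, and both factors on the right are at least `2n + 1`.
    have : ((n : ℝ) + 1 / 2) ^ 2 * 4 ≤ (s + (2 * n : ℕ)) * (s + (2 * n + 1 : ℕ)) := by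
      push_cast
      nlinarith
    calc _ = |halfProdSq n| * 4 ^ n * (((n : ℝ) + 1 / 2) ^ 2 * 4) := by ring
      _ ≤ risingProd (2 * n) s * ((s + (2 * n : ℕ)) * (s + (2 * n + 1 : ℕ))) :=
        mul_le_mul ih this (by positivity) (risingProd_pos _ (by positivity)).le
      _ = _ := by ring

theorem risingHarmonic_nonneg (m : ℕ) {s : ℝ} (hs : 1 ≤ s) : 0 ≤ risingHarmonic m s :=
  sum_nonneg fun _ _ => by positivity

theorem risingHarmonic_le (m : ℕ) {s : ℝ} (hs : 1 ≤ s) : risingHarmonic m s ≤ m := by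
  calc risingHarmonic m s ≤ ∑ j ∈ range m, (1 : ℝ) := by
        refine sum_le_sum fun j _ => ?_
        have : (0 : ℝ) ≤ j := j.cast_nonneg
        rw [div_le_one (by positivity)]; linarith
    _ = m := by simp

theorem abs_halfProdSq_div_le (n : ℕ) {s : ℝ} (hs : 1 ≤ s) :
    |halfProdSq n| / risingProd (2 * n) s ≤ (1 / 4) ^ n := by
  rw [div_le_iff₀ (risingProd_pos _ (by positivity)), one_div, inv_pow, inv_mul_eq_div,
    le_div_iff₀ (by positivity)]
  exact abs_halfProdSq_le n hs

theorem abs_wzF_le (n : ℕ) {s : ℝ} (hs : 1 ≤ s) :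
    |wzF n s| ≤ (2 * n + 4) * (1 / 4) ^ n * (4 / s ^ 2) := by
  have hn : (0 : ℝ) ≤ n := n.cast_nonneg
  have hc : s / 2 ≤ s + n - 1 / 2 := by linarith
  have hc0 : 0 < s + n - 1 / 2 := by linarith
  have hP := risingProd_pos (2 * n) (s := s) (by positivity)
  have hh := risingHarmonic_nonneg (2 * n) hs
  have hh' := risingHarmonic_le (2 * n) hs
  push_cast at hh'
  have b1 : 2 / (s + n - 1 / 2) ≤ 4 := by rw [div_le_iff₀ hc0]; linarith
  have b2 : 1 / (s + n - 1 / 2) ^ 2 ≤ 4 / s ^ 2 := by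
    calc 1 / (s + n - 1 / 2) ^ 2 ≤ 1 / (s / 2) ^ 2 := by gcongr
      _ = 4 / s ^ 2 := by field_simp; norm_num
  have e : |wzF n s| = (risingHarmonic (2 * n) s + 2 / (s + n - 1 / 2)) *
      (|halfProdSq n| / risingProd (2 * n) s) * (1 / (s + n - 1 / 2) ^ 2) := by
    rw [wzF, abs_mul, abs_div, abs_of_pos (show 0 < risingProd (2 * n) s * _ by positivity),
      abs_of_nonneg (show 0 ≤ risingHarmonic (2 * n) s + _ by positivity)]
    field_simp
  rw [e]
  have := abs_halfProdSq_div_le n hs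
  gcongr

theorem abs_wzG_le (n : ℕ) {s : ℝ} (hs : 1 ≤ s) :
    |wzG n s| ≤ (10 * n + 25) * (1 / 4) ^ n * (1 / s) := by
  have hn : (0 : ℝ) ≤ n := n.cast_nonneg
  have hc0 : 1 / 2 ≤ s + n - 1 / 2 := by linarith
  have hc2 : s + 2 * n ≤ 2 * (s + n - 1 / 2) := by linarith
  have hP := risingProd_pos (2 * n) (s := s) (by positivity)
  have hh := risingHarmonic_nonneg (2 * n + 1) hs
  have hh' := risingHarmonic_le (2 * n + 1) hs
  push_cast at hh'
  rw [wzG, risingProd_succ]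
  set c := s + n - 1 / 2
  have hcpos : 0 < c := by linarith
  have b0 : 1 / c ≤ 2 := by rw [div_le_iff₀ hcpos]; linarith
  have b1 : (s + 2 * n) / c ^ 2 ≤ 4 := by
    calc (s + 2 * n) / c ^ 2 ≤ 2 * c / c ^ 2 := by gcongr
      _ = 2 * (1 / c) := by field_simp
      _ ≤ 4 := by linarith
  have b2 : 1 / c ^ 2 ≤ 4 := by
    calc 1 / c ^ 2 = (1 / c) ^ 2 := (one_div_pow c 2).symm
      _ ≤ 2 ^ 2 := by gcongr
      _ = 4 := by norm_num
  have b3 : 2 * (s + 2 * n) / c ^ 3 ≤ 16 := by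
    calc 2 * (s + 2 * n) / c ^ 3 = 2 * ((s + 2 * n) / c ^ 2 * (1 / c)) := by field_simp
      _ ≤ 2 * (4 * 2) := by gcongr
      _ = 16 := by norm_num
  have b4 : 1 / (2 * (n : ℝ) + 1) ≤ 1 := by rw [div_le_one (by positivity)]; linarith
  have p1 : 0 ≤ 1 / c ^ 2 := by positivity
  have p2 : 0 ≤ 2 * (s + 2 * n) / c ^ 3 := by positivity
  have p3 : 0 ≤ (s + 2 * n) / c ^ 2 + 1 / (2 * n + 1) := by positivity
  have b5 : ((s + 2 * n) / c ^ 2 + 1 / (2 * n + 1)) * risingHarmonic (2 * n + 1) s ≤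
      5 * (2 * n + 1) := mul_le_mul (by linarith) hh' hh (by norm_num)
  have b6 := mul_nonneg p3 hh
  have key : |((s + 2 * n) / c ^ 2 + 1 / (2 * n + 1)) * risingHarmonic (2 * n + 1) s
      - 1 / c ^ 2 + 2 * (s + 2 * n) / c ^ 3| ≤ 10 * (n : ℝ) + 25 := by
    rw [abs_le]; constructor <;> linarith
  have b7 : 1 / (s + 2 * n) ≤ 1 / s := by gcongr; linarith
  have b8 := abs_halfProdSq_div_le n hs
  push_cast
  rw [abs_mul, abs_div, abs_of_pos (show 0 < risingProd (2 * n) s * (s + 2 * n) by positivity)]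
  calc _ = |((s + 2 * n) / c ^ 2 + 1 / (2 * n + 1)) * risingHarmonic (2 * n + 1) s
      - 1 / c ^ 2 + 2 * (s + 2 * n) / c ^ 3| * (|halfProdSq n| / risingProd (2 * n) s) *
        (1 / (s + 2 * n)) := by field_simp
    _ ≤ _ := by gcongr

/-! ### Telescoping and limits -/

theorem sum_wzG_sub (N K : ℕ) :
    ∑ n ∈ range N, wzG n 1 - ∑ n ∈ range N, wzG n (K + 1) =
      ∑ k ∈ range K, wzF 0 (k + 1) - ∑ k ∈ range K, wzF N (k + 1) := by
  have h1 (n : ℕ) : ∑ k ∈ range K, (wzG n ((k : ℝ) + 1) - wzG n ((k : ℝ) + 1 + 1)) =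
      wzG n 1 - wzG n (K + 1) := by
    simpa using sum_range_sub' (fun k : ℕ => wzG n ((k : ℝ) + 1)) K
  rw [← sum_sub_distrib, ← sum_sub_distrib]
  simp_rw [← h1]
  rw [sum_comm]
  refine sum_congr rfl fun k _ => ?_
  rw [sum_congr rfl fun n _ => wzG_sub_wzG n (s := (k : ℝ) + 1) (by simp)]
  exact sum_range_sub' (fun n => wzF n ((k : ℝ) + 1)) N

theorem summable_four_div_sq : Summable fun k : ℕ => 4 / ((k : ℝ) + 1) ^ 2 := by
  have := (summable_nat_add_iff 1).2 (Real.summable_one_div_nat_pow.2 (one_lt_two))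
  simpa [div_eq_mul_inv] using this.mul_left 4

theorem summable_wzF (n : ℕ) : Summable fun k : ℕ => wzF n (k + 1) :=
  Summable.of_norm_bounded (summable_four_div_sq.mul_left _)
    fun k => abs_wzF_le n (s := (k : ℝ) + 1) (by simp)

/-- This is the limit `K → ∞` at fixed `N`: the far edge tends to zero because `wzG n s` is `O(1 /
s)`. -/
theorem sum_wzG_eq (N : ℕ) :
    ∑ n ∈ range N, wzG n 1 = ∑' k : ℕ, wzF 0 (k + 1) - ∑' k : ℕ, wzF N (k + 1) := by
  have hG : Tendsto (fun K : ℕ => ∑ n ∈ range N, wzG n (K + 1)) atTop (𝓝 0) := by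
    rw [← sum_const_zero (s := range N)]
    refine tendsto_finsetSum _ fun n _ => ?_
    refine squeeze_zero_norm (fun K => abs_wzG_le n (s := (K : ℝ) + 1) (by simp)) ?_
    simpa using (tendsto_one_div_add_atTop_nhds_zero_nat (𝕜 := ℝ)).const_mul
      ((10 * (n : ℝ) + 25) * (1 / 4) ^ n)
  have hF (n : ℕ) := (summable_wzF n).hasSum.tendsto_sum_nat
  have h := ((hF 0).sub (hF N)).add hG
  simp_rw [← sum_wzG_sub, sub_add_cancel, add_zero] at h
  exact tendsto_nhds_unique tendsto_const_nhds h

theorem summable_linear_mul_geometric (a b : ℝ) :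
    Summable fun n : ℕ => (a * n + b) * (1 / 4 : ℝ) ^ n := by
  have h1 := summable_pow_mul_geometric_of_norm_lt_one 1 (r := (1 / 4 : ℝ)) (by norm_num)
  have h2 := summable_geometric_of_lt_one (r := (1 / 4 : ℝ)) (by norm_num) (by norm_num)
  refine ((h1.mul_left a).add (h2.mul_left b)).congr fun n => ?_
  ring

theorem tendsto_tsum_wzF : Tendsto (fun N => ∑' k : ℕ, wzF N (k + 1)) atTop (𝓝 0) := by
  have hlim := (summable_linear_mul_geometric 2 4).tendsto_atTop_zero.mul_const
    (∑' k : ℕ, 4 / ((k : ℝ) + 1) ^ 2)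
  rw [zero_mul] at hlim
  refine squeeze_zero_norm (fun N => ?_) hlim
  rw [← tsum_mul_left]
  exact tsum_of_norm_bounded (summable_four_div_sq.mul_left _).hasSum
    fun k => abs_wzF_le N (s := (k : ℝ) + 1) (by simp)

theorem hasSum_wzG : HasSum (fun n => wzG n 1) (∑' k : ℕ, wzF 0 (k + 1)) := by
  have hs : Summable fun n => wzG n 1 :=
    Summable.of_norm_bounded (summable_linear_mul_geometric 10 25)
      fun n => by simpa using abs_wzG_le n (s := 1) le_rfl
  rw [hs.hasSum_iff_tendsto_nat]
  simp_rw [sum_wzG_eq]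
  simpa using tendsto_tsum_wzF.const_sub (∑' k : ℕ, wzF 0 (k + 1))

/-! ### Evaluation of the two edges -/

theorem wzF_zero (k : ℕ) : wzF 0 (k + 1) = 16 * (1 / (2 * (k : ℝ) + 1) ^ 3) := by
  have h : (k : ℝ) + 1 + (0 : ℕ) - 1 / 2 = (2 * k + 1) / 2 := by push_cast; ring
  rw [wzF, h]
  have : (2 * (k : ℝ) + 1) ≠ 0 := by positivity
  simp [risingProd, risingHarmonic, halfProdSq]
  field_simp
  norm_num

theorem tsum_wzF_zero :
    ((∑' k : ℕ, wzF 0 (k + 1) : ℝ) : ℂ) = 14 * riemannZeta 3 := by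
  have hz : riemannZeta 3 = ((∑' n : ℕ, 1 / (n : ℝ) ^ 3 : ℝ) : ℂ) := by
    have := zeta_nat_eq_tsum_of_gt_one (k := 3) (by norm_num)
    push_cast at this ⊢
    exact this
  have hs : Summable fun n : ℕ => 1 / (n : ℝ) ^ 3 :=
    Real.summable_one_div_nat_pow.2 (by norm_num)
  have he : ∑' k : ℕ, 1 / ((2 * k : ℕ) : ℝ) ^ 3 = 1 / 8 * ∑' n : ℕ, 1 / (n : ℝ) ^ 3 := by
    rw [← tsum_mul_left]
    refine tsum_congr fun k => ?_
    push_cast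
    rw [mul_pow, one_div_mul_one_div]
    norm_num
  have hsplit := tsum_even_add_odd (f := fun n : ℕ => 1 / (n : ℝ) ^ 3)
    (hs.comp_injective (mul_right_injective₀ two_ne_zero))
    (hs.comp_injective ((add_left_injective 1).comp (mul_right_injective₀ two_ne_zero)))
  rw [he] at hsplit
  simp_rw [wzF_zero]
  rw [tsum_mul_left, hz]
  push_cast at hsplit
  -- The even terms contribute `ζ(3) / 8`, so the odd ones give `7/8` of `ζ(3)`.
  have : 16 * ∑' k : ℕ, 1 / (2 * (k : ℝ) + 1) ^ 3 = 14 * ∑' n : ℕ, 1 / (n : ℝ) ^ 3 := by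
    linarith
  rw [this, Complex.ofReal_mul]
  norm_num

theorem halfProdSq_eq (n : ℕ) :
    halfProdSq n = ((2 * n).choose n : ℝ) * (2 * n).factorial / (-16) ^ n := by
  induction n with
  | zero => simp [halfProdSq]
  | succ n ih =>
    have h := Nat.succ_mul_centralBinom_succ n
    rw [Nat.centralBinom, Nat.centralBinom] at h
    have h' : ((n : ℝ) + 1) * ((2 * (n + 1)).choose (n + 1) : ℝ) =
        2 * (2 * n + 1) * ((2 * n).choose n : ℝ) := by exact_mod_cast h
    have hc : ((2 * (n + 1)).choose (n + 1) : ℝ) =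
        2 * (2 * n + 1) * ((2 * n).choose n : ℝ) / (n + 1) := by
      rw [eq_div_iff (by positivity), ← h', mul_comm]
    rw [halfProdSq_succ, ih, hc, show 2 * (n + 1) = 2 * n + 1 + 1 by ring, Nat.factorial_succ,
      Nat.factorial_succ, pow_succ]
    push_cast
    field_simp
    ring

theorem risingProd_one (m : ℕ) : risingProd m 1 = m.factorial := by
  rw [risingProd, ← prod_range_add_one_eq_factorial]
  push_cast
  exact prod_congr rfl fun _ _ => add_comm _ _

theorem risingHarmonic_one (m : ℕ) : risingHarmonic m 1 = (harmonic m : ℚ) := by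
  rw [risingHarmonic, harmonic]
  push_cast
  exact sum_congr rfl fun _ _ => by rw [one_div, add_comm]

/-- At `s = 1`, `s + n - 1/2` is half of `d = 2n + 1`, so the coefficients arise as `4/d + 1/d =
5/d` and `-4/d^2 + 16/d^2 = 12/d^2`. -/
theorem wzG_one (n : ℕ) :
    wzG n 1 = ((2 * n).choose n : ℝ) / ((2 * (n : ℝ) + 1) ^ 2 * (-16) ^ n) *
      (5 * ((harmonic (2 * n + 1) : ℚ) : ℝ) + 12 / (2 * (n : ℝ) + 1)) := by
  have hf : ((2 * n).factorial : ℝ) ≠ 0 := by positivity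
  have h1 : 2 * (n : ℝ) + 1 ≠ 0 := by positivity
  have h2 : (1 : ℝ) + n - 1 / 2 = (2 * n + 1) / 2 := by ring
  have h3 : (1 : ℝ) + 2 * n = 2 * n + 1 := by ring
  rw [wzG, halfProdSq_eq, risingProd_one, risingHarmonic_one, Nat.factorial_succ, h2, h3]
  push_cast
  field_simp
  ring

theorem mainTheorem2 :
    HasSum
      (fun n : ℕ =>
        ((2 * n).choose n : ℂ) / ((2 * (n : ℂ) + 1) ^ 2 * (-16 : ℂ) ^ n) *
          (5 * ((harmonic (2 * n + 1) : ℚ) : ℂ) + 12 / (2 * (n : ℂ) + 1)))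
      (14 * riemannZeta 3) := by
  have h := hasSum_wzG
  simp_rw [wzG_one] at h
  have h' := Complex.hasSum_ofReal.2 h
  rw [tsum_wzF_zero] at h'
  push_cast at h'
  exact h'
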